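/- Let $n$ and $d$ be positive integers and let $p$ be a prime. For a field $\Bbbk$, let $\mathbf{P}(n,d,\Bbbk)$ be the set of polynomials $f\in\Bbbk[x_1,\dots,x_n]$ of degree at most $d$ that vanish at the origin. Taking coefficients identifies $\mathbf{P}(n,d,\Bbbk)$ with $\mathbb{A}^m_{\Bbbk}(\Bbbk)=\Bbbk^m$, where $m$ is the number of nonconstant monomials of degree at most $d$ in $n$ variables. Let $\Bbbk$ be an $F$-finite field of characteristic $p$ (that is, the Frobenius map $\Bbbk\to\Bbbk$ is finite), let $\mathfrak{m}=\langle x_1,\dots,x_n\rangle\subseteq\Bbbk[x_1,\dots,x_n]$, and write $\mathfrak{m}^{[q]}=\langle g^q : g\in\mathfrak{m}\rangle$. The $F$-pure threshold at the origin of $f\in\mathbf{P}(n,d,\Bbbk)$ is the $F$-threshold \[ \operatorname{ft}^{\mathfrak{m}}(f)=\sup_{e\ge 0}\ \frac{\max\{k\in\mathbb{N} : f^k\notin\mathfrak{m}^{[p^e]}\}}{p^e}, \] so that the zero polynomial has $F$-pure threshold $0$. Let $\mathbf{F}(n,d,\Bbbk)$ be the set of all $F$-pure thresholds at the origin of polynomials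 in $\mathbf{P}(n,d,\Bbbk)$, and let $\mathbf{F}(n,d,p)=\bigcup_{\Bbbk}\mathbf{F}(n,d,\Bbbk)$, the union being over all $F$-finite fields $\Bbbk$ of characteristic $p$. Theorem. The set $\mathbf{F}(n,d,p)$ is finite. Moreover, for every $\lambda\in\mathbf{F}(n,d,p)$ there are closed subsets $V,W\subseteq\mathbb{A}^m_{\mathbb{F}_p}$, defined by ideals of polynomials in $m$ variables with coefficients in $\mathbb{F}_p$, such that for every $F$-finite field $\Bbbk$ of characteristic $p$, the set of polynomials in $\mathbf{P}(n,d,\Bbbk)$ whose $F$-pure threshold at the origin equals $\lambda$ is the locally closed set $V(\Bbbk)\setminus W(\Bbbk)$. In particular, the defining equations of this set may depend on $n$, $d$, $p$ and $\lambda$, but not on the field $\Bbbk$. -/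

import Mathlib

universe u

/-- The `q`-th Frobenius power `𝔟^[q] = ⟨f ^ q : f ∈ 𝔟⟩` of an ideal `𝔟` (with `q` a power of the
characteristic). -/
def frobeniusPower {R : Type u} [CommRing R] (b : Ideal R) (q : ℕ) : Ideal R :=
  Ideal.span ((fun f : R => f ^ q) '' (b : Set R))

/-- `ν_𝔞^𝔟(q) = max {k : 𝔞 ^ k ⊄ 𝔟^[q]}`. When `𝔟` is proper and `𝔞` is a finitely generated ideal
contained in the radical of `𝔟`, the set is nonempty and bounded, so that this is a maximum. -/
noncomputable def nuInvariant {R : Type u} [CommRing R] (a b : Ideal R) (q : ℕ) : ℕ :=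
  sSup {k : ℕ | ¬ a ^ k ≤ frobeniusPower b q}

/-- The `F`-threshold `ft^𝔟(𝔞) = sup_q ν_𝔞^𝔟(q) / q`, where `q` runs over the powers of `p`, for
ideals of a ring of characteristic `p`. -/
noncomputable def fThreshold (p : ℕ) {R : Type u} [CommRing R] (a b : Ideal R) : ℝ :=
  ⨆ e : ℕ, (nuInvariant a b (p ^ e) : ℝ) / (p : ℝ) ^ e

/-- A ring of characteristic `p` is `F`-finite if its Frobenius endomorphism is a finite map. -/
def IsFFinite (p : ℕ) (k : Type u) [CommRing k] [ExpChar k p] : Prop :=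
  (frobenius k p).Finite

/-- The homogeneous maximal ideal `⟨x₁, …, xₙ⟩` of `k[x₁, …, xₙ]`. -/
noncomputable def originIdeal (n : ℕ) (k : Type u) [Field k] : Ideal (MvPolynomial (Fin n) k) :=
  Ideal.span (Set.range MvPolynomial.X)

/-- The `F`-pure threshold at the origin of a polynomial `f` that vanishes at the origin: the
`F`-threshold of `⟨f⟩` with respect to the homogeneous maximal ideal. For `f = 0` the value
is `0`, since `⟨0⟩ ^ 0` is the unit ideal. -/
noncomputable def fptAtOrigin (p : ℕ) {n : ℕ} {k : Type u} [Field k]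
    (f : MvPolynomial (Fin n) k) : ℝ :=
  fThreshold p (Ideal.span {f}) (originIdeal n k)

/-- The space `P(n, d, k)` of polynomials over `k` of degree at most `d` in `n` variables that
vanish at the origin. -/
noncomputable def polySpace (n d : ℕ) (k : Type u) [Field k] : Submodule k (MvPolynomial (Fin n) k) where
  carrier := {f | f.totalDegree ≤ d ∧ MvPolynomial.eval (0 : Fin n → k) f = 0}
  zero_mem' := by simp
  add_mem' := by
    rintro f g ⟨hf, hf'⟩ ⟨hg, hg'⟩
    exact ⟨(MvPolynomial.totalDegree_add f g).trans (max_le hf hg), by rw [map_add, hf', hg', add_zero]⟩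
  smul_mem' := by
    rintro c f ⟨hf, hf'⟩
    exact ⟨(MvPolynomial.totalDegree_smul_le c f).trans hf, by rw [MvPolynomial.smul_eval, hf', mul_zero]⟩

/-- The exponents of the nonconstant monomials of degree at most `d` in `n` variables. -/
abbrev MonomialIndex (n d : ℕ) : Type :=
  {v : Fin n →₀ ℕ // v ≠ 0 ∧ v.degree ≤ d}

instance finite_monomialIndex (n d : ℕ) : Finite (MonomialIndex n d) :=
  ((Finsupp.finite_of_degree_le (σ := Fin n) d).subset fun _ hv => hv.2).to_subtype

/-- The identification of `P(n, d, k)` with affine space `k^m`, where `m` is the number of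
nonconstant monomials of degree at most `d` in `n` variables: a polynomial corresponds to the
family of its coefficients. -/
noncomputable def coeffEquiv (n d : ℕ) (k : Type u) [Field k] :
    polySpace n d k ≃ₗ[k] (MonomialIndex n d → k) :=
  LinearEquiv.ofBijective
    { toFun := fun f v => MvPolynomial.coeff v.1 f.1
      map_add' := fun f g => by ext v; simp
      map_smul' := fun c f => by ext v; simp }
    (by
      have h0 : ∀ f : MvPolynomial (Fin n) k,
          MvPolynomial.eval (0 : Fin n → k) f = MvPolynomial.coeff 0 f := fun f => by
        rw [← MvPolynomial.constantCoeff_eq, MvPolynomial.constantCoeff]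
        exact DFunLike.congr_fun (MvPolynomial.ringHom_ext (by simp) (by simp) :
          MvPolynomial.eval (0 : Fin n → k) = MvPolynomial.constantCoeff) f
      constructor
      · rintro ⟨f, hf, hf'⟩ ⟨g, hg, hg'⟩ hfg
        refine Subtype.ext (MvPolynomial.ext _ _ fun v => ?_)
        by_cases hv : v = 0
        · subst hv
          rw [← h0, ← h0, hf', hg']
        · by_cases hd : v.degree ≤ d
          · exact congr_fun hfg ⟨v, hv, hd⟩
          · have key : ∀ r : MvPolynomial (Fin n) k, r.totalDegree ≤ d →
                MvPolynomial.coeff v r = 0 := fun r hr => by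
              by_contra hne
              exact hd ((MvPolynomial.le_totalDegree
                (MvPolynomial.mem_support_iff.2 hne)).trans hr)
            change MvPolynomial.coeff v f = MvPolynomial.coeff v g
            rw [key f hf, key g hg]
      · intro c
        classical
        have := Fintype.ofFinite (MonomialIndex n d)
        refine ⟨⟨∑ v : MonomialIndex n d, MvPolynomial.monomial v.1 (c v), ?_, ?_⟩, ?_⟩
        · refine (MvPolynomial.totalDegree_finsetSum _ _).trans (Finset.sup_le fun v _ => ?_)
          exact (MvPolynomial.totalDegree_monomial_le _ _).trans v.2.2
        · rw [h0, MvPolynomial.coeff_sum]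
          refine Finset.sum_eq_zero fun v _ => ?_
          rw [MvPolynomial.coeff_monomial, if_neg v.2.1]
        · ext w
          change MvPolynomial.coeff w.1 (∑ v : MonomialIndex n d,
            MvPolynomial.monomial v.1 (c v)) = c w
          simp [MvPolynomial.coeff_sum, MvPolynomial.coeff_monomial, Subtype.coe_inj])

/-- `F(n, d, k)`: the `F`-pure thresholds at the origin of the polynomials in `P(n, d, k)`. -/
def fptSetOver (n d p : ℕ) (k : Type u) [Field k] : Set ℝ :=
  {t | ∃ f ∈ polySpace n d k, fptAtOrigin p f = t}

/-- `F(n, d, p)`: the union of the sets `F(n, d, k)` over all `F`-finite fields `k` of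
characteristic `p`. -/
def fptSet (n d p : ℕ) [Fact p.Prime] : Set ℝ :=
  {t | ∃ (k : Type u) (_ : Field k) (_ : CharP k p), IsFFinite p k ∧ t ∈ fptSetOver n d p k}

/-- The points with coordinates in `k` of the locally closed subset `V(I) \ V(J)` of affine space
over `𝔽_p`, for a field `k` of characteristic `p`. -/
def locallyClosedPoints {p : ℕ} [Fact p.Prime] {σ : Type} (I J : Ideal (MvPolynomial σ (ZMod p)))
    (k : Type u) [Field k] [CharP k p] : Set (σ → k) :=
  letI := ZMod.algebra k p
  MvPolynomial.zeroLocus k I \ MvPolynomial.zeroLocus k J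

open MvPolynomial

/-! ### Frobenius powers of ideals. -/

section FrobeniusPower

variable {R : Type u} [CommRing R] (p : ℕ)

/-! Let `ν e` be the largest exponent with `f ^ ν e ∉ 𝔪^[p ^ e]`. Then `ν (e + 1) / p = ν e`, so the
`ν e` are truncations of one base-`p` expansion, and `ν (i + e) % p ^ e` is the block of `e` digits
after the first `i`. Each such block is a jump of `f` at level `e` (`mod_mem_frobeniusJumps`). The
jumps at any level number at most the dimension `N` of the polynomials of degree at most `d`
(`ncard_frobeniusJumps_le`). Pigeonhole makes the digits eventually periodic, with preperiod plus
period at most `N`, so only finitely many expansions occur.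

The condition `fpt ≤ t` is closed, with equations over `𝔽_p`. By finiteness, each level set is the
difference of two such closed sets, for `t` and for the threshold just below it. -/

theorem frobeniusPower_eq_map [ExpChar R p] (J : Ideal R) (e : ℕ) :
    frobeniusPower J (p ^ e) = J.map (iterateFrobenius R p e) := rfl

theorem frobeniusPower_frobeniusPower [ExpChar R p] (J : Ideal R) (e₁ e₂ : ℕ) :
    frobeniusPower (frobeniusPower J (p ^ e₁)) (p ^ e₂) = frobeniusPower J (p ^ (e₁ + e₂)) := by
  simp only [frobeniusPower_eq_map, Ideal.map_map]
  congr 1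
  ext x
  simp [iterateFrobenius_def, ← pow_mul, pow_add]

theorem pow_mem_frobeniusPower {J : Ideal R} {g : R} (hg : g ∈ J) (q : ℕ) :
    g ^ q ∈ frobeniusPower J q :=
  Ideal.subset_span ⟨g, hg, rfl⟩

end FrobeniusPower

/-! ### Polynomials as a free module over their `q`-th powers. -/

section FrobeniusRoot

variable {σ : Type*} (p e : ℕ) {K : Type u} [Field K] [ExpChar K p] [PerfectRing K p]

open Classical in
/-- Over a perfect field, every polynomial is uniquely a sum `∑ gₐ ^ q * x ^ a` over the exponents
`a` with entries below `q = p ^ e`; this is the additive map `h ↦ gₐ`. -/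
noncomputable def frobeniusRoot (a : σ →₀ ℕ) : MvPolynomial σ K →+ MvPolynomial σ K :=
  (Finsupp.liftAddHom fun w : σ →₀ ℕ =>
    if w.mapRange (· % p ^ e) (Nat.zero_mod _) = a then
      (monomial (w.mapRange (· / p ^ e) (Nat.zero_div _))).toAddMonoidHom.comp
        (iterateFrobeniusEquiv K p e).symm.toAddMonoidHom
    else 0).comp AddMonoidAlgebra.coeffAddEquiv.toAddMonoidHom

open Classical in
theorem frobeniusRoot_monomial (a w : σ →₀ ℕ) (b : K) :
    frobeniusRoot p e a (monomial w b) =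
      if w.mapRange (· % p ^ e) (Nat.zero_mod _) = a then
        monomial (w.mapRange (· / p ^ e) (Nat.zero_div _)) ((iterateFrobeniusEquiv K p e).symm b)
      else 0 := by
  have h : AddMonoidAlgebra.coeff (monomial w b) = Finsupp.single w b :=
    AddMonoidAlgebra.coeff_single w b
  rw [frobeniusRoot, AddMonoidHom.comp_apply]
  change Finsupp.liftAddHom _ (AddMonoidAlgebra.coeff (monomial w b)) = _
  rw [h, Finsupp.liftAddHom_apply_single]
  split_ifs <;> rfl

theorem frobeniusRoot_pow_mul (a : σ →₀ ℕ) (g h : MvPolynomial σ K) :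
    frobeniusRoot p e a (g ^ p ^ e * h) = g * frobeniusRoot p e a h := by
  classical
  induction g using MvPolynomial.induction_on' with
  | add g₁ g₂ h₁ h₂ => rw [add_pow_expChar_pow, add_mul, map_add, h₁, h₂, add_mul]
  | monomial u c =>
    induction h using MvPolynomial.induction_on' with
    | add g₁ g₂ h₁ h₂ => rw [mul_add, map_add, h₁, h₂, map_add, mul_add]
    | monomial w b =>
      have hq : 0 < p ^ e := expChar_pow_pos K p e
      have h1 : (p ^ e • u + w).mapRange (· % p ^ e) (Nat.zero_mod _) =
          w.mapRange (· % p ^ e) (Nat.zero_mod _) := by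
        ext i; simp
      have h2 : (p ^ e • u + w).mapRange (· / p ^ e) (Nat.zero_div _) =
          u + w.mapRange (· / p ^ e) (Nat.zero_div _) := by
        ext i; simp [Nat.mul_add_div hq]
      have h3 : (iterateFrobeniusEquiv K p e).symm (c ^ p ^ e * b) =
          c * (iterateFrobeniusEquiv K p e).symm b := by
        rw [map_mul, ← iterateFrobeniusEquiv_def, RingEquiv.symm_apply_apply]
      rw [monomial_pow, monomial_mul, frobeniusRoot_monomial, frobeniusRoot_monomial, h1, h2, h3]
      split_ifs
      · rw [monomial_mul]
      · rw [mul_zero]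

theorem mem_frobeniusPower_of_frobeniusRoot_mem {J : Ideal (MvPolynomial σ K)}
    {h : MvPolynomial σ K}
    (hJ : ∀ a, frobeniusRoot p e a h ∈ J) :
    h ∈ frobeniusPower J (p ^ e) := by
  classical
  have key : ∑ a ∈ h.support.image (fun w => w.mapRange (· % p ^ e) (Nat.zero_mod _)),
      frobeniusRoot p e a h ^ p ^ e * monomial a 1 = h := by
    set s := h.support.image (fun w => w.mapRange (· % p ^ e) (Nat.zero_mod _)) with hs
    conv_rhs => rw [h.as_sum]
    conv_lhs => rw [h.as_sum]
    simp only [map_sum, ← iterateFrobenius_def p e, Finset.sum_mul]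
    rw [Finset.sum_comm]
    refine Finset.sum_congr rfl fun w hw => ?_
    have hmem := Finset.mem_image_of_mem
      (fun w : σ →₀ ℕ => w.mapRange (· % p ^ e) (Nat.zero_mod _)) hw
    rw [← hs] at hmem
    rw [Finset.sum_eq_single_of_mem _ hmem]
    · rw [frobeniusRoot_monomial, if_pos rfl, iterateFrobenius_def, monomial_pow, monomial_mul,
        mul_one, ← iterateFrobeniusEquiv_def, RingEquiv.apply_symm_apply]
      refine congrArg (fun v => monomial v _) (Finsupp.ext fun i => ?_)
      simp [Nat.div_add_mod]
    · intro a _ ha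
      rw [frobeniusRoot_monomial, if_neg (Ne.symm ha), map_zero, zero_mul]
  rw [← key]
  exact Ideal.sum_mem _ fun a _ => Ideal.mul_mem_right _ _ (pow_mem_frobeniusPower (hJ a) _)

theorem mem_frobeniusPower_iff {J : Ideal (MvPolynomial σ K)} {h : MvPolynomial σ K} :
    h ∈ frobeniusPower J (p ^ e) ↔ ∀ a, frobeniusRoot p e a h ∈ J := by
  refine ⟨fun hh a => one_mul h ▸ ?_, mem_frobeniusPower_of_frobeniusRoot_mem p e⟩
  -- Roots are linear only over `q`-th powers, so the induction carries an arbitrary multiplier `c`.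
  refine Submodule.span_induction (p := fun h _ => ∀ c, frobeniusRoot p e a (c * h) ∈ J)
    ?_ ?_ ?_ ?_ hh 1
  · rintro _ ⟨g, hg, rfl⟩ c
    rw [mul_comm, frobeniusRoot_pow_mul]
    exact J.mul_mem_right _ hg
  · intro c; rw [mul_zero, map_zero]; exact J.zero_mem
  · intro x y _ _ hx hy c; rw [mul_add, map_add]; exact J.add_mem (hx c) (hy c)
  · intro b x _ hx c
    rw [smul_eq_mul, ← mul_assoc]
    exact hx _

/-- Frobenius powers commute with the colon ideal `(J : g)`, as flatness of Frobenius predicts. -/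
theorem pow_mul_mem_frobeniusPower_iff {J : Ideal (MvPolynomial σ K)} {g h : MvPolynomial σ K} :
    g ^ p ^ e * h ∈ frobeniusPower J (p ^ e) ↔
      h ∈ frobeniusPower (Submodule.comap (LinearMap.mulLeft (MvPolynomial σ K) g) J) (p ^ e) := by
  simp [mem_frobeniusPower_iff, frobeniusRoot_pow_mul]

theorem frobeniusRoot_mem_restrictSupport {d : ℕ} (a : σ →₀ ℕ) {h : MvPolynomial σ K}
    (hh : h.totalDegree ≤ p ^ e * d) :
    frobeniusRoot p e a h ∈ restrictSupport K {v : σ →₀ ℕ | v.degree ≤ d} := by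
  classical
  rw [h.as_sum, map_sum]
  refine Submodule.sum_mem _ fun w hw => ?_
  rw [frobeniusRoot_monomial]
  split_ifs
  · rw [monomial_mem_restrictSupport]
    refine .inl (Nat.le_of_mul_le_mul_left ?_ (expChar_pow_pos K p e))
    refine le_trans ?_ ((le_totalDegree hw).trans hh)
    rw [← smul_eq_mul, ← map_nsmul]
    refine Finsupp.degree_mono fun i => ?_
    simpa using Nat.mul_div_le (w i) (p ^ e)
  · exact Submodule.zero_mem _

end FrobeniusRoot

/-- In a nontrivial relation, the term of least index would lie in the subspace that excludes it. -/
theorem linearIndependent_of_triangular {ι K V : Type*} [LinearOrder ι] [Field K] [AddCommGroup V]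
    [Module K V] {v : ι → V} (W : ι → Submodule K V) (hv : ∀ i, v i ∉ W i)
    (hW : ∀ i j, i < j → v j ∈ W i) : LinearIndependent K v := by
  classical
  rw [linearIndependent_iff']
  intro s g hg
  by_contra! hne
  obtain ⟨i, hi, hgi⟩ := hne
  obtain ⟨r, hr, hmin⟩ := (s.filter (g · ≠ 0)).exists_minimal ⟨i, by simp [hi, hgi]⟩
  rw [Finset.mem_filter] at hr
  rw [← Finset.add_sum_erase _ _ hr.1] at hg
  have hmem : g r • v r ∈ W r := by
    rw [eq_neg_of_add_eq_zero_left hg]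
    refine (W r).neg_mem (Submodule.sum_mem _ fun j hj => ?_)
    rw [Finset.mem_erase] at hj
    by_cases hgj : g j = 0
    · simp [hgj]
    · refine (W r).smul_mem _ (hW r j (lt_of_le_of_ne ?_ hj.1.symm))
      rcases le_total r j with h | h
      · exact h
      · exact hmin (by simp [hj.2, hgj]) h
  exact hv r (((W r).smul_mem_iff hr.2).1 hmem)

/-! ### Counting and restricting jumps. -/

section Jumps

/-- The exponents `r < p ^ e` at which the powers `f ^ r` and `f ^ (r + 1)` are separated by the
`p ^ e`-th Frobenius power of an ideal. -/
def frobeniusJumps (p e : ℕ) {R : Type u} [CommRing R] (f : R) : Set ℕ :=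
  {r | r < p ^ e ∧ ∃ J : Ideal R,
    f ^ (r + 1) ∈ frobeniusPower J (p ^ e) ∧ f ^ r ∉ frobeniusPower J (p ^ e)}

theorem finite_frobeniusJumps (p e : ℕ) {R : Type u} [CommRing R] (f : R) :
    (frobeniusJumps p e f).Finite :=
  (Set.finite_lt_nat (p ^ e)).subset fun _ hr => hr.1

variable {σ : Type*} (p : ℕ) {K : Type u} [Field K] [ExpChar K p] [PerfectRing K p]

/-- Each jump `r` yields a root of `f ^ r` outside an ideal containing all roots of higher powers,
so these roots are independent. As `r < p ^ e`, they have degree at most `d`, which makes the bound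
independent of `e`. -/
theorem ncard_frobeniusJumps_le [Finite σ] {d e : ℕ} {f : MvPolynomial σ K}
    (hf : f.totalDegree ≤ d) :
    (frobeniusJumps p e f).ncard ≤ Nat.card {v : σ →₀ ℕ | v.degree ≤ d} := by
  have hJ : ∀ r : frobeniusJumps p e f, ∃ (J : Ideal (MvPolynomial σ K)) (a : σ →₀ ℕ),
      frobeniusRoot p e a (f ^ (r : ℕ)) ∉ J ∧
        ∀ s, (r : ℕ) < s → ∀ b, frobeniusRoot p e b (f ^ s) ∈ J := by
    rintro ⟨r, -, J, h1, h2⟩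
    rw [mem_frobeniusPower_iff] at h2
    push Not at h2
    obtain ⟨a, ha⟩ := h2
    refine ⟨J, a, ha, fun s hs => ?_⟩
    rw [← mem_frobeniusPower_iff]
    exact Ideal.mem_of_dvd _ (pow_dvd_pow f hs) h1
  choose J a ha hJ using hJ
  have hdeg : ∀ r : frobeniusJumps p e f,
      frobeniusRoot p e (a r) (f ^ (r : ℕ)) ∈ restrictSupport K {v : σ →₀ ℕ | v.degree ≤ d} :=
    fun r => frobeniusRoot_mem_restrictSupport p e _
      ((totalDegree_pow _ _).trans (Nat.mul_le_mul r.2.1.le hf))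
  have hli : LinearIndependent K fun r : frobeniusJumps p e f =>
      frobeniusRoot p e (a r) (f ^ (r : ℕ)) :=
    linearIndependent_of_triangular (fun r => (J r).restrictScalars K) ha
      fun i j hij => hJ i j hij _
  have hli' : LinearIndependent K fun r : frobeniusJumps p e f =>
      (⟨_, hdeg r⟩ : restrictSupport K {v : σ →₀ ℕ | v.degree ≤ d}) :=
    LinearIndependent.of_comp (Submodule.subtype _) hli
  have := (Finsupp.finite_of_degree_le (σ := σ) d).to_subtype
  have := (finite_frobeniusJumps p e f).fintype
  have : Module.Finite K (restrictSupport K {v : σ →₀ ℕ | v.degree ≤ d}) :=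
    Module.Finite.of_basis (basisRestrictSupport K _)
  have h := hli'.fintype_card_le_finrank
  rwa [Module.finrank_eq_nat_card_basis (basisRestrictSupport K _), ← Nat.card_eq_fintype_card]
    at h

theorem mod_mem_frobeniusJumps {i e r : ℕ} {f : MvPolynomial σ K}
    (hr : r ∈ frobeniusJumps p (i + e) f) : r % p ^ e ∈ frobeniusJumps p e f := by
  obtain ⟨-, J, h1, h2⟩ := hr
  refine ⟨Nat.mod_lt _ (expChar_pow_pos K p e), ?_⟩
  rw [← frobeniusPower_frobeniusPower] at h1 h2
  have hs : ∀ s, f ^ (p ^ e * (r / p ^ e) + s) = (f ^ (r / p ^ e)) ^ p ^ e * f ^ s := fun s => by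
    rw [pow_add, mul_comm (p ^ e), pow_mul]
  conv at h1 => rw [← Nat.div_add_mod r (p ^ e), add_assoc, hs, pow_mul_mem_frobeniusPower_iff]
  conv at h2 => rw [← Nat.div_add_mod r (p ^ e), hs, pow_mul_mem_frobeniusPower_iff]
  -- The separating ideal is the colon of `J^[p ^ i]` by `f ^ (r / p ^ e)`.
  exact ⟨_, h1, h2⟩

theorem pow_mem_frobeniusPower_iff {e : ℕ} {J : Ideal (MvPolynomial σ K)}
    {g : MvPolynomial σ K} : g ^ p ^ e ∈ frobeniusPower J (p ^ e) ↔ g ∈ J := by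
  refine ⟨fun h => ?_, fun h => pow_mem_frobeniusPower h _⟩
  rw [mem_frobeniusPower_iff] at h
  have := h 0
  rwa [← mul_one (g ^ p ^ e), frobeniusRoot_pow_mul, ← map_one C, ← monomial_zero',
    frobeniusRoot_monomial, if_pos (by simp), map_one, Finsupp.mapRange_zero, monomial_zero',
    map_one, mul_one] at this

end Jumps

/-! ### Frobenius powers of the ideal of the origin. -/

section Origin

variable (p : ℕ) {n : ℕ} {k : Type u} [Field k]

theorem mem_frobeniusPower_originIdeal_iff [ExpChar k p] {e : ℕ} {f : MvPolynomial (Fin n) k} :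
    f ∈ frobeniusPower (originIdeal n k) (p ^ e) ↔
      ∀ w : Fin n →₀ ℕ, (∀ i, w i < p ^ e) → coeff w f = 0 := by
  have h : frobeniusPower (originIdeal n k) (p ^ e) =
      Ideal.span ((fun s => monomial s (1 : k)) '' Set.range fun i => Finsupp.single i (p ^ e)) := by
    rw [frobeniusPower_eq_map, originIdeal, Ideal.map_span, ← Set.range_comp, ← Set.range_comp]
    congr 2
    ext1 i
    simp [iterateFrobenius_def, X_pow_eq_monomial]
  rw [h, mem_ideal_span_monomial_image]
  refine forall_congr' fun w => ?_
  simp only [mem_support_iff, Set.exists_range_iff, Finsupp.single_le_iff]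
  constructor
  · intro h hw
    by_contra hne
    obtain ⟨i, hi⟩ := h hne
    exact (hw i).not_ge hi
  · intro h hne
    by_contra! hw
    exact hne (h hw)

/-- Membership is the vanishing of certain coefficients, so it is insensitive to field extension. -/
theorem map_mem_frobeniusPower_originIdeal_iff {K : Type*} [Field K] [ExpChar k p] [ExpChar K p]
    (φ : k →+* K) {e : ℕ} {f : MvPolynomial (Fin n) k} :
    map φ f ∈ frobeniusPower (originIdeal n K) (p ^ e) ↔
      f ∈ frobeniusPower (originIdeal n k) (p ^ e) := by
  simp only [mem_frobeniusPower_originIdeal_iff, coeff_map, map_eq_zero]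

theorem mem_originIdeal_of_eval_eq_zero {f : MvPolynomial (Fin n) k} (hf : eval 0 f = 0) :
    f ∈ originIdeal n k := by
  rw [originIdeal, ← Set.image_univ, mem_ideal_span_X_image]
  intro w hw
  by_contra! h
  have hw0 : w = 0 := Finsupp.ext fun i => h i trivial
  rw [eval_zero, constantCoeff_eq] at hf
  exact mem_support_iff.1 hw (hw0 ▸ hf)

variable {f : MvPolynomial (Fin n) k}

theorem lt_of_pow_notMem_frobeniusPower {e r : ℕ}
    (h : f ^ r ∉ frobeniusPower (originIdeal n k) (p ^ e)) (hf : eval 0 f = 0) : r < p ^ e := by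
  by_contra! hr
  exact h (Ideal.mem_of_dvd _ (pow_dvd_pow f hr)
    (pow_mem_frobeniusPower (mem_originIdeal_of_eval_eq_zero hf) _))

variable [ExpChar k p]

theorem le_nuInvariant_iff (hf : eval 0 f = 0) {e r : ℕ} :
    r ≤ nuInvariant (Ideal.span {f}) (originIdeal n k) (p ^ e) ↔
      f ^ r ∉ frobeniusPower (originIdeal n k) (p ^ e) := by
  have hset : {r : ℕ | ¬ Ideal.span {f} ^ r ≤ frobeniusPower (originIdeal n k) (p ^ e)} =
      {r | f ^ r ∉ frobeniusPower (originIdeal n k) (p ^ e)} := by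
    ext r
    simp [Ideal.span_singleton_pow]
  have hbdd : BddAbove {r | f ^ r ∉ frobeniusPower (originIdeal n k) (p ^ e)} :=
    ⟨p ^ e, fun r hr => (lt_of_pow_notMem_frobeniusPower p hr hf).le⟩
  have hne : {r | f ^ r ∉ frobeniusPower (originIdeal n k) (p ^ e)}.Nonempty := by
    refine ⟨0, fun h => ?_⟩
    have := (mem_frobeniusPower_originIdeal_iff p).1 h 0 fun i => expChar_pow_pos k p e
    simp at this
  rw [nuInvariant, hset]
  refine ⟨fun h hr => ?_, fun h => le_csSup hbdd h⟩
  exact Nat.sSup_mem hne hbdd (Ideal.mem_of_dvd _ (pow_dvd_pow f h) hr)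

theorem nuInvariant_lt (hf : eval 0 f = 0) (e : ℕ) :
    nuInvariant (Ideal.span {f}) (originIdeal n k) (p ^ e) < p ^ e :=
  lt_of_pow_notMem_frobeniusPower p ((le_nuInvariant_iff p hf).1 le_rfl) hf

theorem nuInvariant_map {K : Type*} [Field K] [ExpChar K p] (φ : k →+* K) (hf : eval 0 f = 0)
    (e : ℕ) : nuInvariant (Ideal.span {map φ f}) (originIdeal n K) (p ^ e) =
      nuInvariant (Ideal.span {f}) (originIdeal n k) (p ^ e) := by
  have hf' : eval 0 (map φ f) = 0 := by
    rw [eval_zero] at hf ⊢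
    rw [constantCoeff_map, hf, map_zero]
  refine eq_of_forall_le_iff fun r => ?_
  rw [le_nuInvariant_iff p hf', le_nuInvariant_iff p hf, ← map_pow,
    map_mem_frobeniusPower_originIdeal_iff]

theorem nuInvariant_mem_frobeniusJumps (hf : eval 0 f = 0) (e : ℕ) :
    nuInvariant (Ideal.span {f}) (originIdeal n k) (p ^ e) ∈ frobeniusJumps p e f :=
  ⟨nuInvariant_lt p hf e, originIdeal n k,
    not_not.1 (mt (le_nuInvariant_iff p hf).2 (Nat.lt_succ_self _).not_ge),
    (le_nuInvariant_iff p hf).1 le_rfl⟩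

theorem nuInvariant_succ_div [PerfectRing k p] (hf : eval 0 f = 0) (e : ℕ) :
    nuInvariant (Ideal.span {f}) (originIdeal n k) (p ^ (e + 1)) / p =
      nuInvariant (Ideal.span {f}) (originIdeal n k) (p ^ e) := by
  refine eq_of_forall_le_iff fun r => ?_
  rw [Nat.le_div_iff_mul_le (expChar_pos k p), le_nuInvariant_iff p hf, le_nuInvariant_iff p hf,
    ← frobeniusPower_frobeniusPower, pow_mul]
  have := pow_mem_frobeniusPower_iff p (e := 1) (J := frobeniusPower (originIdeal n k) (p ^ e))
    (g := f ^ r)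
  rw [pow_one] at this ⊢
  rw [this]

end Origin

/-! ### Digit sequences with few blocks. -/

section DigitSequences

variable {p : ℕ}

theorem add_div_pow_of_succ_div {ν : ℕ → ℕ} (h : ∀ e, ν (e + 1) / p = ν e) (m j : ℕ) :
    ν (m + j) / p ^ j = ν m := by
  induction j with
  | zero => simp
  | succ j ih => rw [pow_succ', ← Nat.div_div_eq_div_mul, ← add_assoc, h, ih]

theorem exists_period_of_ncard_le (hp : 0 < p) {N : ℕ} {ν : ℕ → ℕ}
    (hdiv : ∀ e, ν (e + 1) / p = ν e)
    (hcard : ∀ e, (Set.range fun i => ν (i + e) % p ^ e).ncard ≤ N) :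
    ∃ i j, i < j ∧ j ≤ N ∧ ∀ e, ν (i + e) % p ^ e = ν (j + e) % p ^ e := by
  have hfin : ∀ e, (Set.range fun i => ν (i + e) % p ^ e).Finite := fun e =>
    (Set.finite_lt_nat (p ^ e)).subset (by rintro _ ⟨i, rfl⟩; exact Nat.mod_lt _ (by positivity))
  have hex : ∀ e, ∃ x : Fin (N + 1) × Fin (N + 1), x.1 < x.2 ∧
      ν (x.1 + e) % p ^ e = ν (x.2 + e) % p ^ e := by
    intro e
    obtain ⟨a, -, b, -, hab, heq⟩ := Finset.exists_ne_map_eq_of_card_lt_of_maps_to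
      (s := (Finset.univ : Finset (Fin (N + 1)))) (t := (hfin e).toFinset)
      (f := fun i => ν (i + e) % p ^ e)
      (by rw [← Set.ncard_eq_toFinset_card _ (hfin e), Finset.card_univ, Fintype.card_fin]
          exact Nat.lt_succ_of_le (hcard e))
      (fun i _ => by simp)
    rcases hab.lt_or_gt with h | h
    · exact ⟨(a, b), h, heq⟩
    · exact ⟨(b, a), h, heq.symm⟩
  choose x hlt hx using hex
  -- The colliding pair depends on `e`; one pair recurs for arbitrarily large `e`, and agreement of
  -- long blocks passes to their initial segments.
  obtain ⟨⟨i, j⟩, hinf⟩ := Finite.exists_infinite_fiber x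
  rw [Set.infinite_coe_iff] at hinf
  have hij : i < j := by
    obtain ⟨e, he⟩ := hinf.nonempty
    have := hlt e
    rwa [show x e = (i, j) from he] at this
  refine ⟨i, j, hij, Nat.lt_succ_iff.1 j.2, fun e => ?_⟩
  obtain ⟨e', he', hle⟩ := hinf.exists_gt e
  obtain ⟨c, rfl⟩ := Nat.exists_eq_add_of_lt hle
  have hxe := hx (e + c + 1)
  rw [show x (e + c + 1) = (i, j) from he'] at hxe
  have key : ∀ l, ν (l + e) % p ^ e = ν (l + (e + c + 1)) % p ^ (e + c + 1) / p ^ (c + 1) := by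
    intro l
    rw [← add_div_pow_of_succ_div hdiv (l + e) (c + 1), ← Nat.mod_mul_right_div_self, ← pow_add]
    congr 3 <;> ring
  rw [key, key, hxe]

/-- The first `j` digits are common, and each later digit repeats the one `j - i` places before. -/
theorem eq_of_period {i j : ℕ} (hij : i < j) {μ ν : ℕ → ℕ}
    (hμ : ∀ e, μ (e + 1) / p = μ e) (hν : ∀ e, ν (e + 1) / p = ν e) (h : μ j = ν j)
    (hμ' : ∀ e, μ (i + e) % p ^ e = μ (j + e) % p ^ e)
    (hν' : ∀ e, ν (i + e) % p ^ e = ν (j + e) % p ^ e) : μ = ν := by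
  funext m
  induction m using Nat.strong_induction_on with
  | _ m ih =>
    rcases le_or_gt m j with hm | hm
    · obtain ⟨c, rfl⟩ := Nat.exists_eq_add_of_le hm
      rw [← add_div_pow_of_succ_div hμ m c, ← add_div_pow_of_succ_div hν m c, h]
    · obtain ⟨e, rfl⟩ := Nat.exists_eq_add_of_lt hm
      have digit : ∀ {ν : ℕ → ℕ}, (∀ e, ν (i + e) % p ^ e = ν (j + e) % p ^ e) →
          ν (j + e + 1) % p = ν (i + e + 1) % p := fun {ν} hν => by
        have := congrArg (· % p) (hν (e + 1))
        simpa [Nat.mod_mod_of_dvd _ (dvd_pow_self p e.succ_ne_zero), ← add_assoc] using this.symm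
      rw [← Nat.div_add_mod (μ (j + e + 1)) p, ← Nat.div_add_mod (ν (j + e + 1)) p, hμ, hν,
        ih _ (Nat.lt_succ_self _), digit hμ', digit hν', ih (i + e + 1) (by lia)]

theorem finite_setOf_ncard_range_mod_le (hp : 0 < p) (N : ℕ) :
    {ν : ℕ → ℕ | (∀ e, ν e < p ^ e) ∧ (∀ e, ν (e + 1) / p = ν e) ∧
      ∀ e, (Set.range fun i => ν (i + e) % p ^ e).ncard ≤ N}.Finite := by
  refine (Set.finite_iUnion (ι := Fin (N + 1) × Fin (N + 1) × Fin (p ^ N))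
    (f := fun x => {ν : ℕ → ℕ | x.1 < x.2.1 ∧ ν x.2.1 = x.2.2 ∧ (∀ e, ν (e + 1) / p = ν e) ∧
      ∀ e, ν (x.1 + e) % p ^ e = ν (x.2.1 + e) % p ^ e}) fun x => ?_).subset ?_
  · refine Set.Subsingleton.finite ?_
    rintro μ ⟨hij, hμj, hμ, hμ'⟩ ν ⟨-, hνj, hν, hν'⟩
    exact eq_of_period hij hμ hν (hμj.trans hνj.symm) hμ' hν'
  · rintro ν ⟨hlt, hdiv, hcard⟩
    obtain ⟨i, j, hij, hj, h⟩ := exists_period_of_ncard_le hp hdiv hcard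
    exact Set.mem_iUnion.2 ⟨(⟨i, by lia⟩, ⟨j, by lia⟩,
      ⟨ν j, (hlt j).trans_le (Nat.pow_le_pow_right hp hj)⟩), hij, rfl, hdiv, h⟩

end DigitSequences

/-! ### Finiteness of the set of thresholds. -/

section Threshold

variable (p : ℕ) {n d : ℕ} {k : Type u} [Field k] {f : MvPolynomial (Fin n) k}

theorem bddAbove_nuInvariant_div [ExpChar k p] (hf : eval 0 f = 0) :
    BddAbove (Set.range fun e : ℕ =>
      (nuInvariant (Ideal.span {f}) (originIdeal n k) (p ^ e) : ℝ) / (p : ℝ) ^ e) := by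
  refine ⟨1, ?_⟩
  rintro _ ⟨e, rfl⟩
  refine div_le_one_of_le₀ ?_ (by positivity)
  exact_mod_cast (nuInvariant_lt p hf e).le

theorem fptAtOrigin_nonneg (p : ℕ) (f : MvPolynomial (Fin n) k) : 0 ≤ fptAtOrigin p f :=
  Real.iSup_nonneg fun _ => by positivity

theorem fptAtOrigin_le_iff [ExpChar k p] (hf : eval 0 f = 0) {t : ℝ} (ht : 0 ≤ t) :
    fptAtOrigin p f ≤ t ↔
      ∀ e, f ^ (⌊t * (p : ℝ) ^ e⌋₊ + 1) ∈ frobeniusPower (originIdeal n k) (p ^ e) := by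
  have hp : 0 < (p : ℝ) := by exact_mod_cast expChar_pos k p
  rw [fptAtOrigin, fThreshold, ciSup_le_iff (bddAbove_nuInvariant_div p hf)]
  refine forall_congr' fun e => ?_
  rw [div_le_iff₀ (by positivity), ← Nat.le_floor_iff (by positivity), ← not_iff_not,
    ← le_nuInvariant_iff p hf, not_le, Nat.lt_iff_add_one_le]

theorem nuInvariant_mem_of_totalDegree_le [ExpChar k p] (hf : eval 0 f = 0)
    (hd : f.totalDegree ≤ d) :
    (fun e => nuInvariant (Ideal.span {f}) (originIdeal n k) (p ^ e)) ∈
      {ν : ℕ → ℕ | (∀ e, ν e < p ^ e) ∧ (∀ e, ν (e + 1) / p = ν e) ∧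
        ∀ e, (Set.range fun i => ν (i + e) % p ^ e).ncard ≤
          Nat.card {v : Fin n →₀ ℕ | v.degree ≤ d}} := by
  -- Frobenius roots need a perfect field; the invariants do not change in the algebraic closure.
  let φ := algebraMap k (AlgebraicClosure k)
  have : ExpChar (AlgebraicClosure k) p := expChar_of_injective_algebraMap φ.injective p
  have hf' : eval 0 (map φ f) = 0 := by
    rw [eval_zero] at hf ⊢
    rw [constantCoeff_map, hf, map_zero]
  simp only [← nuInvariant_map p φ hf]
  refine ⟨nuInvariant_lt p hf', nuInvariant_succ_div p hf', fun e => ?_⟩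
  refine (Set.ncard_le_ncard ?_ (finite_frobeniusJumps p e (map φ f))).trans
    (ncard_frobeniusJumps_le p ((Finset.sup_mono (support_map_subset φ f)).trans hd))
  rintro _ ⟨i, rfl⟩
  exact mod_mem_frobeniusJumps p (nuInvariant_mem_frobeniusJumps p hf' (i + e))

theorem finite_fptSet (n d p : ℕ) [Fact p.Prime] : (fptSet.{u} n d p).Finite := by
  refine ((finite_setOf_ncard_range_mod_le (Fact.out : p.Prime).pos
    (Nat.card {v : Fin n →₀ ℕ | v.degree ≤ d})).image
      fun ν : ℕ → ℕ => ⨆ e : ℕ, (ν e : ℝ) / (p : ℝ) ^ e).subset ?_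
  rintro _ ⟨k, _, _, -, f, ⟨hd, hf⟩, rfl⟩
  exact ⟨_, nuInvariant_mem_of_totalDegree_le p hf hd, rfl⟩

end Threshold

/-! ### Closedness of `fpt ≤ t` over `𝔽_p`. -/

section Closed

/-- The polynomial of degree at most `d` without constant term whose coefficients are
indeterminates over `𝔽_p`. -/
noncomputable def genericPolynomial (n d p : ℕ) :
    MvPolynomial (Fin n) (MvPolynomial (MonomialIndex n d) (ZMod p)) :=
  letI := Fintype.ofFinite (MonomialIndex n d)
  ∑ v : MonomialIndex n d, monomial v.1 (X v)

/-- The equations over `𝔽_p` of the polynomials whose `F`-pure threshold is at most `t`. -/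
noncomputable def fptLEIdeal (n d p : ℕ) (t : ℝ) :
    Ideal (MvPolynomial (MonomialIndex n d) (ZMod p)) :=
  Ideal.span {g | ∃ (e : ℕ) (w : Fin n →₀ ℕ), (∀ i, w i < p ^ e) ∧
    g = coeff w (genericPolynomial n d p ^ (⌊t * (p : ℝ) ^ e⌋₊ + 1))}

variable {n d p : ℕ} {k : Type u} [Field k]

theorem map_genericPolynomial [Algebra (ZMod p) k] (f : polySpace n d k) :
    map (aeval (coeffEquiv n d k f) : _ →ₐ[ZMod p] k).toRingHom (genericPolynomial n d p) = f := by
  classical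
  let _ := Fintype.ofFinite (MonomialIndex n d)
  ext w
  have h : coeff w (map (aeval (coeffEquiv n d k f) : _ →ₐ[ZMod p] k).toRingHom
      (genericPolynomial n d p)) =
      ∑ v : MonomialIndex n d, if v.1 = w then coeff v.1 (f : MvPolynomial (Fin n) k) else 0 := by
    simp only [genericPolynomial, map_sum, map_monomial, coeff_sum, coeff_monomial]
    refine Finset.sum_congr rfl fun v _ => ?_
    split_ifs
    · exact aeval_X _ v
    · rfl
  rw [h]
  by_cases hw : w ≠ 0 ∧ w.degree ≤ d
  · rw [Finset.sum_eq_single_of_mem ⟨w, hw⟩ (Finset.mem_univ _), if_pos rfl]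
    exact fun v _ hv => if_neg fun h => hv (Subtype.ext h)
  · have hv : ∀ v : MonomialIndex n d, v.1 ≠ w := fun v h => hw (by rw [← h]; exact v.2)
    rw [Finset.sum_eq_zero fun v _ => if_neg (hv v)]
    by_contra hne
    refine hw ⟨?_, (le_totalDegree (mem_support_iff.2 (Ne.symm hne))).trans f.2.1⟩
    rintro rfl
    have := f.2.2
    rw [eval_zero, constantCoeff_eq] at this
    exact hne this.symm

theorem mem_zeroLocus_fptLEIdeal_iff [Fact p.Prime] [ExpChar k p] [Algebra (ZMod p) k] (f : polySpace n d k)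
    {t : ℝ} (ht : 0 ≤ t) :
    coeffEquiv n d k f ∈ zeroLocus k (fptLEIdeal n d p t) ↔
      fptAtOrigin p (f : MvPolynomial (Fin n) k) ≤ t := by
  have hspan : coeffEquiv n d k f ∈ zeroLocus k (fptLEIdeal n d p t) ↔
      fptLEIdeal n d p t ≤ RingHom.ker (aeval (coeffEquiv n d k f) : _ →ₐ[ZMod p] k) := Iff.rfl
  rw [hspan, fptLEIdeal, Ideal.span_le, fptAtOrigin_le_iff p f.2.2 ht]
  simp only [mem_frobeniusPower_originIdeal_iff]
  have key : ∀ (r : ℕ) (w : Fin n →₀ ℕ), aeval (coeffEquiv n d k f)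
      (coeff w (genericPolynomial n d p ^ r)) = coeff w ((f : MvPolynomial (Fin n) k) ^ r) := by
    intro r w
    conv_rhs => rw [← map_genericPolynomial (p := p) f, ← map_pow, coeff_map]
    rfl
  constructor
  · intro h e w hw
    rw [← key]
    exact h ⟨e, w, hw, rfl⟩
  · rintro h _ ⟨e, w, hw, rfl⟩
    exact (key _ w).trans (h e w hw)

end Closed

theorem mainTheorem5 (n d p : ℕ) (hn : 0 < n) (hd : 0 < d) [Fact p.Prime] :
    (fptSet.{u} n d p).Finite ∧
    ∀ t ∈ fptSet.{u} n d p, ∃ I J : Ideal (MvPolynomial (MonomialIndex n d) (ZMod p)),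
      ∀ (k : Type u) [Field k] [CharP k p], IsFFinite p k →
        {f : polySpace n d k | fptAtOrigin p (f : MvPolynomial (Fin n) k) = t} =
          coeffEquiv n d k ⁻¹' locallyClosedPoints I J k := by
  have hfin := finite_fptSet.{u} n d p
  have hnonneg : ∀ t ∈ fptSet.{u} n d p, 0 ≤ t := by
    rintro _ ⟨k, _, _, -, f, -, rfl⟩
    exact fptAtOrigin_nonneg p f
  refine ⟨hfin, fun t ht => ⟨fptLEIdeal n d p t, ?_⟩⟩
  -- If `t` is the least threshold, nothing is removed: the unit ideal has empty zero locus.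
  -- Otherwise the set removed is `fpt ≤ s`, with `s` the predecessor of `t`.
  rcases {s ∈ fptSet.{u} n d p | s < t}.eq_empty_or_nonempty with hempty | hne
  · refine ⟨⊤, fun k hF hC hk => Set.ext fun f => ?_⟩
    let _ := ZMod.algebra k p
    have hmem : fptAtOrigin p (f : MvPolynomial (Fin n) k) ∈ fptSet.{u} n d p :=
      ⟨k, hF, hC, hk, f, f.2, rfl⟩
    have hle : t ≤ fptAtOrigin p (f : MvPolynomial (Fin n) k) := by
      by_contra! hlt
      exact Set.eq_empty_iff_forall_notMem.1 hempty _ ⟨hmem, hlt⟩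
    change _ ↔ _ ∈ zeroLocus k _ \ zeroLocus k _
    rw [zeroLocus_top, Set.mem_sdiff, mem_zeroLocus_fptLEIdeal_iff f (hnonneg t ht)]
    exact ⟨fun h => ⟨h.le, id⟩, fun h => h.1.antisymm hle⟩
  · obtain ⟨s, ⟨hs, hst⟩, hmax⟩ := Set.exists_max_image _ id (hfin.sep _) hne
    refine ⟨fptLEIdeal n d p s, fun k hF hC hk => Set.ext fun f => ?_⟩
    let _ := ZMod.algebra k p
    have hmem : fptAtOrigin p (f : MvPolynomial (Fin n) k) ∈ fptSet.{u} n d p :=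
      ⟨k, hF, hC, hk, f, f.2, rfl⟩
    change _ ↔ _ ∈ zeroLocus k _ \ zeroLocus k _
    rw [Set.mem_sdiff, mem_zeroLocus_fptLEIdeal_iff f (hnonneg t ht),
      mem_zeroLocus_fptLEIdeal_iff f (hnonneg s hs)]
    refine ⟨fun h => ⟨h.le, fun h' => (h'.trans_lt hst).ne h⟩, fun h => h.1.antisymm ?_⟩
    by_contra! hlt
    exact h.2 (hmax _ ⟨hmem, hlt⟩)
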